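/- Let $\mathbb F_q\subseteq\mathbb F_{q^r}\subseteq\mathbb F_{q^t}$ be finite fields ($r\mid t$), let $\theta(a)=a^q$ on $\mathbb F_{q^t}$, and let $m\ge 1$. Let $R=\mathbb F_{q^t}[X_1,\dots,X_m;\theta]$ be the almost commutative multivariate Ore polynomial ring: the variables commute with each other, $X_ia=aX_i$ for $i<m$ and $X_ma=\theta(a)X_m$, for all $a\in\mathbb F_{q^t}$. A finite set $S\subseteq\mathbb F_{q^t}$ is called P-independent if the least common left multiple of $\{X-s : s\in S\}$ in $\mathbb F_{q^t}[X;\theta]$ has degree $|S|$. Let $S_1,\dots,S_m\subseteq\mathbb F_{q^t}$ be nonempty sets such that $0\notin S_m$ and both $S_m$ and $S_m^{-1}=\{s^{-1}:s\in S_m\}$ are P-independent. Put $\mathcal S=S_1\times\cdots\times S_m$ and $n=|\mathcal S|$. For $i<m$ let $g_i\in\mathbb F_{q^t}[X_i]$ satisfy $g_i(s)\ne 0$ for all $s\in S_i$. Let $g_m\in\mathbb F_{q^t}[X_m;\theta]$ be nonzero and invariant, i.e. $g_m\,\mathbb F_{q^t}[X_m;\theta]=\mathbb F_{q^t}[X_m;\theta]\,g_m$,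 and such that the greatest common right divisor of $X_m-s$ and $g_m$ is $1$ for all $s\in S_m$. Put $g=g_1\cdots g_m$ and, by convention, $\deg g=\prod_{i=1}^m\deg g_i$. For $s\in S_i$ let $h_{i,s}$ be the unique polynomial in $\mathbb F_{q^t}[X_i]$ (in $\mathbb F_{q^t}[X_m;\theta]$ if $i=m$) such that $\deg h_{i,s}<\deg g_i$ and $h_{i,s}(X_i-s)-1$ is a left multiple of $g_i$. For $j=(s_1,\dots,s_m)\in\mathcal S$ put $h_j=h_{1,s_1}\cdots h_{m,s_m}\in R$. Let $\eta_s\in\mathbb F_{q^t}^*$ for $s\in S_m$, and for $j=(s_1,\dots,s_m)\in\mathcal S$ put $\eta_j=\eta_{s_m}$. The Generalized Skew Multivariate Goppa code is $$\tilde\Gamma(\mathcal S,\eta,g,\mathbb F_{q^r})=\Big\{c\in\mathbb F_{q^r}^{\mathcal S} : \sum_{j\in\mathcal S}c_j\eta_jh_j=0\Big\}.$$ Then $\tilde\Gamma(\mathcal S,\eta,g,\mathbb F_{q^r})$ has - length $n=|\mathcal S|$; - dimension $k$ over $\mathbb F_{q^r}$ satisfying $k\ge n-\frac tr\deg g$ and,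 provided that $\deg g_i\le |S_i|$ for all $i=1,\dots,m$, also $k\le n-\deg g$; - minimum distance $d\ge\min_{1\le i\le m}(\deg g_i+1)$ (where $d=\infty$ for the zero code). -/

import Mathlib

noncomputable section

namespace SkewGoppa

/-! ### Ore polynomial rings -/

section Ore

variable {F : Type*} [Field F]

/-- The monoid of monomials `X^u`, `u ∈ A`, of an Ore polynomial ring in which the monomial `X^u`
commutes past a scalar through the `w u`-th power of `θ`, i.e. `X^u * a = θ^(w u) (a) * X^u`. -/
def OreMonoid (_θ : F →+* F) {A : Type} [AddCommMonoid A] (_w : A →+ ℕ) : Type :=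
  Multiplicative A

instance (θ : F →+* F) {A : Type} [AddCommMonoid A] (w : A →+ ℕ) : CommMonoid (OreMonoid θ w) :=
  inferInstanceAs (CommMonoid (Multiplicative A))

/-- The monomial `X^u`. -/
def OreMonoid.mk (θ : F →+* F) {A : Type} [AddCommMonoid A] (w : A →+ ℕ) (u : A) :
    OreMonoid θ w :=
  Multiplicative.ofAdd u

/-- The exponent `u` of the monomial `X^u`. -/
def OreMonoid.exponent {θ : F →+* F} {A : Type} [AddCommMonoid A] {w : A →+ ℕ}
    (u : OreMonoid θ w) : A :=
  Multiplicative.toAdd u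

/-- The monomial `X^u` acts on the scalars by `θ^(w u)`. -/
instance (θ : F →+* F) {A : Type} [AddCommMonoid A] (w : A →+ ℕ) :
    MulSemiringAction (OreMonoid θ w) F where
  smul u a := (θ ^ w u.exponent) a
  one_smul a := by
    change (θ ^ w 0) a = a
    simp
  mul_smul u v a := by
    change (θ ^ w (u.exponent + v.exponent)) a = (θ ^ w u.exponent) ((θ ^ w v.exponent) a)
    rw [map_add, pow_add]
    rfl
  smul_zero u := map_zero (θ ^ w u.exponent)
  smul_add u := map_add (θ ^ w u.exponent)
  smul_one u := map_one (θ ^ w u.exponent)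
  smul_mul u := map_mul (θ ^ w u.exponent)

/-- The univariate Ore polynomial ring `F[X; θ]`: `X * a = θ a * X`. -/
abbrev OrePoly (θ : F →+* F) : Type _ :=
  SkewMonoidAlgebra F (OreMonoid θ (AddMonoidHom.id ℕ))

/-- The almost commutative multivariate Ore polynomial ring `F[X_0, …, X_ℓ; θ]` in `ℓ + 1`
variables: the variables commute with each other, `X_0, …, X_{ℓ-1}` commute with the scalars, and
the last variable satisfies `X_ℓ * a = θ a * X_ℓ`. -/
abbrev MvOrePoly (θ : F →+* F) (ℓ : ℕ) : Type _ :=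
  SkewMonoidAlgebra F (OreMonoid θ (Finsupp.applyAddHom (M := ℕ) (Fin.last ℓ)))

namespace OrePoly

variable {θ : F →+* F}

/-- The constant polynomial `a`. -/
def C (a : F) : OrePoly θ := SkewMonoidAlgebra.single 1 a

/-- The variable `X`. -/
def X : OrePoly θ := SkewMonoidAlgebra.single (OreMonoid.mk θ (AddMonoidHom.id ℕ) 1) 1

/-- The degree, with the convention `deg 0 = -∞`. -/
def degree (f : OrePoly θ) : WithBot ℕ := f.support.sup fun u => ((u.exponent : ℕ) : WithBot ℕ)

/-- The degree as a natural number (with value `0` at `0`). -/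
def natDegree (f : OrePoly θ) : ℕ := f.support.sup fun u => u.exponent

/-- `d` divides `f` on the right, i.e. `f ∈ F[X; θ] d`. -/
def RightDvd (d f : OrePoly θ) : Prop := ∃ p, f = p * d

/-- `(f, g)_r = 1`: every common right divisor of `f` and `g` is a unit. -/
def RightCoprime (f g : OrePoly θ) : Prop := ∀ d, RightDvd d f → RightDvd d g → IsUnit d

/-- `g` is invariant: `g ≠ 0` and `g F[X; θ] = F[X; θ] g`. -/
def Invariant (g : OrePoly θ) : Prop :=
  g ≠ 0 ∧ {f : OrePoly θ | ∃ p, f = g * p} = {f : OrePoly θ | ∃ p, f = p * g}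

/-- `f` is a least common left multiple of the polynomials `X - s`, `s ∈ S`. -/
def IsLCLM (S : Finset F) (f : OrePoly θ) : Prop :=
  (∀ s ∈ S, RightDvd (X - C s) f) ∧
    ∀ f' : OrePoly θ, (∀ s ∈ S, RightDvd (X - C s) f') → RightDvd f f'

/-- `h` is the polynomial with `deg h < deg g` and `h (X - s) - 1 ∈ F[X; θ] g`. (There is exactly
one if `g` is invariant and `(X - s, g)_r = 1`.) -/
def inverseMod (g : OrePoly θ) (s : F) : OrePoly θ :=
  Classical.epsilon fun h => h.degree < g.degree ∧ RightDvd g (h * (X - C s) - 1)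

end OrePoly

/-- `S` is P-independent (with respect to `θ`): the least common left multiple in `F[X; θ]` of the
polynomials `X - s`, `s ∈ S`, has degree `|S|`. -/
def PIndependent (θ : F →+* F) (S : Finset F) : Prop :=
  ∃ f : OrePoly θ, OrePoly.IsLCLM S f ∧ f.natDegree = S.card

/-- `h` is the polynomial with `deg h < deg g` and `h (X - s) - 1 ∈ F[X] g`. (There is exactly one
if `g(s) ≠ 0`.) -/
def inverseMod (g : Polynomial F) (s : F) : Polynomial F :=
  Classical.epsilon fun h =>
    h.degree < g.degree ∧ g ∣ h * (Polynomial.X - Polynomial.C s) - 1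

namespace MvOrePoly

variable {θ : F →+* F} {ℓ : ℕ}

/-- The monomial `a X_i^k`. -/
def monomial (i : Fin (ℓ + 1)) (k : ℕ) (a : F) : MvOrePoly θ ℓ :=
  SkewMonoidAlgebra.single (OreMonoid.mk θ _ (Finsupp.single i k)) a

/-- The inclusion of `F[X_i]`, `i < ℓ`, in `F[X_0, …, X_ℓ; θ]`. -/
def ofPolynomial (θ : F →+* F) {ℓ : ℕ} (i : Fin ℓ) (f : Polynomial F) : MvOrePoly θ ℓ :=
  f.sum fun k a => monomial i.castSucc k a

/-- The inclusion of `F[X_ℓ; θ]` in `F[X_0, …, X_ℓ; θ]`. -/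
def ofOrePoly (ℓ : ℕ) (f : OrePoly θ) : MvOrePoly θ ℓ :=
  f.sum fun u a => monomial (Fin.last ℓ) u.exponent a

end MvOrePoly

end Ore

/-! ### Linear codes -/

section Codes

variable {E ι : Type*} [Field E] [Fintype ι]

/-- The length of a linear code `C ⊆ E^ι`. -/
def codeLength (_C : Submodule E (ι → E)) : ℕ := Fintype.card ι

open Classical in
/-- The minimum Hamming distance, i.e. the minimum Hamming weight of a nonzero codeword
(`⊤` for the zero code). -/
def minDist (C : Submodule E (ι → E)) : ℕ∞ :=
  ⨅ c ∈ C, ⨅ _ : c ≠ 0, (hammingNorm c : ℕ∞)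

end Codes

/-! ### Generalized Skew Multivariate Goppa codes -/

section Goppa

variable {F : Type*} [Field F] {ℓ : ℕ}

/-- For a point `j = (s_0, …, s_ℓ)` the product `h_j = h_0 ⋯ h_ℓ` in `F[X_0, …, X_ℓ; θ]`, where
`h_i` is the inverse of `X_i - s_i` modulo `g_i`. Here `g_0, …, g_{ℓ-1}` are given by `g`, and
`g_ℓ` is `gLast`. -/
def goppaPoly {θ : F →+* F} (g : Fin ℓ → Polynomial F) (gLast : OrePoly θ)
    (j : Fin (ℓ + 1) → F) : MvOrePoly θ ℓ :=
  (List.ofFn fun i : Fin ℓ =>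
      MvOrePoly.ofPolynomial θ i (inverseMod (g i) (j i.castSucc))).prod *
    MvOrePoly.ofOrePoly ℓ (OrePoly.inverseMod gLast (j (Fin.last ℓ)))

/-- The Generalized Skew Multivariate Goppa code over the subfield `E` of `F`: the set of all
`c ∈ E^𝒮` with `∑_j c_j η_j h_j = 0`, where `j` runs over `𝒮 = S_0 × ⋯ × S_ℓ`, and `η_j` depends
only on the last coordinate of `j`. -/
def gsmgCode (E : Type*) [Field E] [Algebra E F] {θ : F →+* F} (S : Fin (ℓ + 1) → Finset F)
    (η : S (Fin.last ℓ) → Fˣ) (g : Fin ℓ → Polynomial F) (gLast : OrePoly θ) :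
    Submodule E ((∀ i, S i) → E) where
  carrier := {c | ∑ j : (∀ i, S i),
    (algebraMap E F (c j) * (η (j (Fin.last ℓ)) : F)) • goppaPoly g gLast (fun i => (j i : F)) = 0}
  add_mem' {c d} hc hd := by
    simp only [Set.mem_ofPred_eq] at hc hd ⊢
    simp only [Pi.add_apply, map_add, add_mul, add_smul, Finset.sum_add_distrib, hc, hd, add_zero]
  zero_mem' := by simp
  smul_mem' a c hc := by
    simp only [Set.mem_ofPred_eq] at hc ⊢
    simp only [Pi.smul_apply, smul_eq_mul, map_mul, mul_assoc, mul_smul (algebraMap E F a)]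
    rw [← Finset.smul_sum, hc, smul_zero]

/-- The degrees `deg g_0, …, deg g_ℓ`. -/
def goppaDegrees {θ : F →+* F} (g : Fin ℓ → Polynomial F) (gLast : OrePoly θ) :
    Fin (ℓ + 1) → ℕ :=
  Fin.snoc (α := fun _ => ℕ) (fun i => (g i).natDegree) gLast.natDegree

end Goppa

end SkewGoppa

end

/-!
The inverse `h_{i,s}` of `X_i - s` modulo `g_i` has degree below `d_i = deg g_i`, so it is a vector
of `d_i` coefficients, and the coefficients of `h_j = h_{0,s_0} ⋯ h_{ℓ,s_ℓ}` are the products of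
those of its factors (`coeffAt_goppaPoly`). The code is thus the kernel of a parity check matrix
whose columns are tensor products, up to the nonzero scalars `η_j`. All bounds follow from one fact:
in each coordinate any `d_i` or fewer of the `h_{i,s}` are linearly independent over the large
field, whence so are the `h_j` for `j` in a box `∏ T_i` with `|T_i| ≤ d_i`
(`eq_zero_of_sum_piFinset_mul_prod`). The code therefore meets the vectors supported on such a
box trivially. A box with `|T_i| = d_i` gives the upper bound on the dimension, and the box spanned
by the support of a codeword of small weight gives the distance. The lower bound on the dimension
just counts parity checks.

In a commutative variable, independence follows by clearing denominators: a relation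
`∑ a_s h_{i,s} = 0` makes `∑ a_s ∏_{y ≠ s} (X - y)` a multiple of `g_i` of degree `< |T|`.

In the skew variable, write `h (X - s) - 1 = p g`, where `p ≠ 0` must be constant. This is a
two-term recurrence for the coefficients of `h`. Invariance of `g` forces `θ^i = θ^d` whenever the
`i`-th coefficient of `g` is nonzero (`d = deg g`), and then the coefficients of `h` are an
invertible triangular transform, not depending on `s`, of the products `p θ^(d-1)(s) ⋯ θ^(d-j)(s)`,
`j < d`. Such a product is `N_d(s) N_{d-j}(s⁻¹)`, with `N_i(s) = s θ(s) ⋯ θ^(i-1)(s)`, so up to an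
application of `θ⁻¹` and scaling of the columns one is left with the skew Vandermonde matrix of the
points `s⁻¹` (`eq_zero_of_sum_mul_coeffAt_inverseMod`). Its columns are independent because `S_ℓ⁻¹`
is P-independent (`PIndependent.eq_zero_of_sum_mul_truncNorm`): `N_i(s)` is the remainder of `X^i`
modulo `X - s`, and no nonzero polynomial of degree below the number of points is right divisible by
all `X - s`.
-/

noncomputable section

namespace SkewGoppa

/-! ### Coefficients of Ore polynomials -/

namespace OrePoly

variable {F : Type*} [Field F] {θ : F →+* F}

theorem pow_add_apply (m n : ℕ) (a : F) : (θ ^ (m + n)) a = (θ ^ m) ((θ ^ n) a) := by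
  rw [pow_add]
  rfl

/-- The coefficient of `X^k`, scalars being written on the left. -/
def coeffAt (f : OrePoly θ) (k : ℕ) : F := f.coeff (OreMonoid.mk θ (AddMonoidHom.id ℕ) k)

theorem ext_coeffAt {f g : OrePoly θ} (h : ∀ k, f.coeffAt k = g.coeffAt k) : f = g :=
  SkewMonoidAlgebra.ext h

@[simp] theorem coeffAt_zero (k : ℕ) : coeffAt (0 : OrePoly θ) k = 0 := rfl

@[simp] theorem coeffAt_add (f g : OrePoly θ) (k : ℕ) :
    coeffAt (f + g) k = coeffAt f k + coeffAt g k := by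
  simp [coeffAt]

@[simp] theorem coeffAt_neg (f : OrePoly θ) (k : ℕ) : coeffAt (-f) k = -coeffAt f k := by
  simp [coeffAt]

@[simp] theorem coeffAt_sub (f g : OrePoly θ) (k : ℕ) :
    coeffAt (f - g) k = coeffAt f k - coeffAt g k := by
  simp [coeffAt]

/-- The monomial `a X^i`. -/
def monomialAt (θ : F →+* F) (i : ℕ) (a : F) : OrePoly θ :=
  SkewMonoidAlgebra.single (OreMonoid.mk θ (AddMonoidHom.id ℕ) i) a

theorem coeffAt_monomialAt (i k : ℕ) (a : F) :
    coeffAt (monomialAt θ i a) k = if i = k then a else 0 := by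
  exact SkewMonoidAlgebra.coeff_single_apply (k := F) (G := Multiplicative ℕ)

theorem C_eq (a : F) : (C a : OrePoly θ) = monomialAt θ 0 a := rfl

theorem X_eq : (X : OrePoly θ) = monomialAt θ 1 1 := rfl

theorem one_eq : (1 : OrePoly θ) = monomialAt θ 0 1 := rfl

theorem coeffAt_mul (p f : OrePoly θ) (n : ℕ) :
    coeffAt (p * f) n =
      ∑ x ∈ Finset.HasAntidiagonal.antidiagonal n, coeffAt p x.1 * (θ ^ x.1) (coeffAt f x.2) := by
  exact SkewMonoidAlgebra.coeff_mul_antidiagonal_of_finset p f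
    (OreMonoid.mk θ (AddMonoidHom.id ℕ) n) (Finset.HasAntidiagonal.antidiagonal (A := ℕ) n)
    (fun {x} => Finset.HasAntidiagonal.mem_antidiagonal (A := ℕ) (n := n) (a := x))

theorem coeffAt_C_mul (a : F) (f : OrePoly θ) (k : ℕ) : coeffAt (C a * f) k = a * coeffAt f k := by
  rw [coeffAt_mul, Finset.sum_eq_single (0, k)]
  · simp [C_eq, coeffAt_monomialAt]
  · rintro ⟨i, j⟩ hij hne
    rw [Finset.HasAntidiagonal.mem_antidiagonal] at hij
    have : i ≠ 0 := by rintro rfl; simp_all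
    simp [C_eq, coeffAt_monomialAt, this.symm]
  · simp

theorem coeffAt_mul_C (f : OrePoly θ) (a : F) (k : ℕ) :
    coeffAt (f * C a) k = coeffAt f k * (θ ^ k) a := by
  rw [coeffAt_mul, Finset.sum_eq_single (k, 0)]
  · simp [C_eq, coeffAt_monomialAt]
  · rintro ⟨i, j⟩ hij hne
    rw [Finset.HasAntidiagonal.mem_antidiagonal] at hij
    have : j ≠ 0 := by rintro rfl; simp_all
    simp [C_eq, coeffAt_monomialAt, this.symm]
  · simp

theorem coeffAt_mul_X_zero (f : OrePoly θ) : coeffAt (f * X) 0 = 0 := by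
  simp [coeffAt_mul, X_eq, coeffAt_monomialAt]

theorem coeffAt_mul_X_succ (f : OrePoly θ) (k : ℕ) : coeffAt (f * X) (k + 1) = coeffAt f k := by
  rw [coeffAt_mul, Finset.sum_eq_single (k, 1)]
  · simp [X_eq, coeffAt_monomialAt]
  · rintro ⟨i, j⟩ hij hne
    rw [Finset.HasAntidiagonal.mem_antidiagonal] at hij
    have : j ≠ 1 := by rintro rfl; simp_all
    simp [X_eq, coeffAt_monomialAt, this.symm]
  · simp

theorem coeffAt_mul_X_sub_C_zero (f : OrePoly θ) (s : F) :
    coeffAt (f * (X - C s)) 0 = -(coeffAt f 0 * s) := by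
  rw [mul_sub, coeffAt_sub, coeffAt_mul_X_zero, coeffAt_mul_C]
  simp

theorem coeffAt_mul_X_sub_C_succ (f : OrePoly θ) (s : F) (k : ℕ) :
    coeffAt (f * (X - C s)) (k + 1) = coeffAt f k - coeffAt f (k + 1) * (θ ^ (k + 1)) s := by
  rw [mul_sub, coeffAt_sub, coeffAt_mul_X_succ, coeffAt_mul_C]

/-! ### Degrees of Ore polynomials -/

theorem coeffAt_eq_zero_of_natDegree_lt {f : OrePoly θ} {k : ℕ} (h : f.natDegree < k) :
    coeffAt f k = 0 := by
  by_contra hne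
  have : k ≤ f.natDegree :=
    Finset.le_sup (f := fun u : OreMonoid θ (AddMonoidHom.id ℕ) => (u.exponent : ℕ))
      (SkewMonoidAlgebra.mem_support_iff.2 hne)
  omega

theorem natDegree_le_of_coeffAt {f : OrePoly θ} {n : ℕ} (h : ∀ k, n < k → coeffAt f k = 0) :
    f.natDegree ≤ n := by
  refine Finset.sup_le fun u hu => ?_
  by_contra hlt
  exact SkewMonoidAlgebra.mem_support_iff.1 hu (h _ (not_le.1 hlt))

theorem coeffAt_natDegree_ne_zero {f : OrePoly θ} (hf : f ≠ 0) : coeffAt f f.natDegree ≠ 0 := by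
  have hne : f.support.Nonempty := by
    rw [Finset.nonempty_iff_ne_empty]
    simpa using hf
  obtain ⟨u, hu, h⟩ := Finset.exists_mem_eq_sup f.support hne
    (fun u : OreMonoid θ (AddMonoidHom.id ℕ) => (u.exponent : ℕ))
  rw [natDegree, h]
  exact SkewMonoidAlgebra.mem_support_iff.1 hu

theorem le_natDegree_of_coeffAt_ne_zero {f : OrePoly θ} {k : ℕ} (h : coeffAt f k ≠ 0) :
    k ≤ f.natDegree :=
  not_lt.1 fun hlt => h (coeffAt_eq_zero_of_natDegree_lt hlt)

theorem degree_lt_iff {f : OrePoly θ} {n : ℕ} :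
    f.degree < n ↔ ∀ k, n ≤ k → coeffAt f k = 0 := by
  rw [degree, Finset.sup_lt_iff (by simp [bot_lt_iff_ne_bot])]
  constructor
  · intro h k hk
    by_contra hne
    have := h _ (SkewMonoidAlgebra.mem_support_iff.2 hne)
    have : k < n := by exact_mod_cast this
    omega
  · intro h u hu
    by_contra hlt
    refine SkewMonoidAlgebra.mem_support_iff.1 hu (h _ ?_)
    exact_mod_cast not_lt.1 hlt

theorem degree_eq_natDegree {f : OrePoly θ} (hf : f ≠ 0) : f.degree = f.natDegree := by
  apply le_antisymm
  · refine Finset.sup_le fun u hu => ?_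
    exact_mod_cast Finset.le_sup
      (f := fun u : OreMonoid θ (AddMonoidHom.id ℕ) => (u.exponent : ℕ)) hu
  · by_contra hlt
    exact coeffAt_natDegree_ne_zero hf (degree_lt_iff.1 (not_le.1 hlt) _ le_rfl)

theorem coeffAt_mul_natDegree_add (p f : OrePoly θ) :
    coeffAt (p * f) (p.natDegree + f.natDegree) =
      coeffAt p p.natDegree * (θ ^ p.natDegree) (coeffAt f f.natDegree) := by
  rw [coeffAt_mul, Finset.sum_eq_single (p.natDegree, f.natDegree)]
  · rintro ⟨i, j⟩ hij hne
    rw [Finset.HasAntidiagonal.mem_antidiagonal] at hij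
    rcases lt_trichotomy i p.natDegree with h | h | h
    · simp [coeffAt_eq_zero_of_natDegree_lt (f := f) (k := j) (by simp at hij; omega)]
    · exact absurd (Prod.ext h (by simp at hij ⊢; omega)) hne
    · simp [coeffAt_eq_zero_of_natDegree_lt h]
  · simp

theorem coeffAt_mul_natDegree_add_ne_zero {p f : OrePoly θ} (hp : p ≠ 0) (hf : f ≠ 0) :
    coeffAt (p * f) (p.natDegree + f.natDegree) ≠ 0 := by
  rw [coeffAt_mul_natDegree_add]
  exact mul_ne_zero (coeffAt_natDegree_ne_zero hp)
    ((map_ne_zero _).2 (coeffAt_natDegree_ne_zero hf))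

instance : NoZeroDivisors (OrePoly θ) where
  eq_zero_or_eq_zero_of_mul_eq_zero {p f} h := by
    by_contra! hne
    exact coeffAt_mul_natDegree_add_ne_zero hne.1 hne.2 (by rw [h, coeffAt_zero])

theorem natDegree_add_le_natDegree_mul {p f : OrePoly θ} (hp : p ≠ 0) (hf : f ≠ 0) :
    p.natDegree + f.natDegree ≤ (p * f).natDegree :=
  le_natDegree_of_coeffAt_ne_zero (coeffAt_mul_natDegree_add_ne_zero hp hf)

theorem eq_C_of_natDegree_mul_le {p g : OrePoly θ} (hg : g ≠ 0)
    (h : ∀ k, g.natDegree < k → coeffAt (p * g) k = 0) : p = C (coeffAt p 0) := by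
  rcases eq_or_ne p 0 with rfl | hp
  · refine ext_coeffAt fun k => ?_
    simp [C_eq, coeffAt_monomialAt]
  have h1 := natDegree_add_le_natDegree_mul hp hg
  have h2 := natDegree_le_of_coeffAt h
  refine ext_coeffAt fun k => ?_
  rw [C_eq, coeffAt_monomialAt]
  split_ifs with hk
  · rw [hk]
  · exact coeffAt_eq_zero_of_natDegree_lt (by omega)

theorem X_sub_C_ne_zero (s : F) : (X - C s : OrePoly θ) ≠ 0 := by
  intro h
  have := congrArg (fun f => coeffAt f 1) h
  simp [X_eq, C_eq, coeffAt_monomialAt] at this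

/-! ### Division by `X - s` and P-independence -/

theorem exists_eq_mul_X_sub_C_add_C (s : F) (n : ℕ) (g : OrePoly θ)
    (hg : ∀ k, n < k → coeffAt g k = 0) :
    ∃ (u : OrePoly θ) (c : F), g = u * (X - C s) + C c ∧ ∀ k, n ≤ k → coeffAt u k = 0 := by
  induction n generalizing g with
  | zero =>
    refine ⟨0, coeffAt g 0, ?_, by simp⟩
    refine ext_coeffAt fun k => ?_
    rw [zero_mul, zero_add, C_eq, coeffAt_monomialAt]
    split_ifs with hk
    · rw [hk]
    · exact hg k (by omega)
  | succ n ih =>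
    obtain ⟨u, c, h, hu⟩ := ih (g - monomialAt θ n (coeffAt g (n + 1)) * (X - C s)) (by
      intro k hk
      obtain ⟨k, rfl⟩ : ∃ m, k = m + 1 := ⟨k - 1, by omega⟩
      rw [coeffAt_sub, coeffAt_mul_X_sub_C_succ, coeffAt_monomialAt, coeffAt_monomialAt]
      have hk' : n ≠ k + 1 := by omega
      rcases eq_or_ne n k with rfl | hne
      · simp
      · simp [hne, hk', hg (k + 1) (by omega)])
    refine ⟨u + monomialAt θ n (coeffAt g (n + 1)), c, ?_, fun k hk => ?_⟩
    · rw [add_mul, add_right_comm, ← h, sub_add_cancel]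
    · rw [coeffAt_add, coeffAt_monomialAt, hu k (by omega), if_neg (by omega), add_zero]

theorem X_sub_C_mul_C (s c : F) (hc : c ≠ 0) :
    ((X - C (θ c * s * c⁻¹)) * C c : OrePoly θ) = C (θ c) * (X - C s) := by
  refine ext_coeffAt fun k => ?_
  rw [coeffAt_mul_C, coeffAt_C_mul]
  simp only [coeffAt_sub, X_eq, C_eq, coeffAt_monomialAt]
  match k with
  | 0 => simp [hc]
  | 1 => simp
  | k + 2 => simp

/-- A nonzero polynomial has a left multiple, larger in degree by at most `|U|`, that is right
divisible by all `X - s`, `s ∈ U`: if `f` has nonzero remainder `c` modulo `X - s`, then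
`(X - θ(c) s c⁻¹) f` is divisible by `X - s`. -/
theorem exists_mul_ne_zero_forall_rightDvd {f : OrePoly θ} (hf : f ≠ 0) {m : ℕ}
    (hm : ∀ k, m < k → coeffAt f k = 0) (U : Finset F) :
    ∃ p : OrePoly θ, p * f ≠ 0 ∧ (∀ k, m + U.card < k → coeffAt (p * f) k = 0) ∧
      ∀ s ∈ U, RightDvd (X - C s) (p * f) := by
  classical
  induction U using Finset.induction_on with
  | empty => exact ⟨1, by simpa using hf, by simpa using hm, by simp⟩
  | insert s U hs ih =>
    obtain ⟨p, hp, hdeg, hdvd⟩ := ih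
    rw [Finset.card_insert_of_notMem hs]
    obtain ⟨u, c, hu, -⟩ := exists_eq_mul_X_sub_C_add_C s _ (p * f) hdeg
    rcases eq_or_ne c 0 with rfl | hc
    · refine ⟨p, hp, fun k hk => hdeg k (by omega), fun x hx => ?_⟩
      rcases Finset.mem_insert.1 hx with rfl | hx
      · refine ⟨u, hu.trans ?_⟩
        rw [add_eq_left]
        simp [C]
      · exact hdvd x hx
    · refine ⟨(X - C (θ c * s * c⁻¹)) * p, ?_, fun k hk => ?_, fun x hx => ?_⟩
      · rw [mul_assoc]
        exact mul_ne_zero (X_sub_C_ne_zero _) hp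
      · rw [mul_assoc, coeffAt_mul]
        refine Finset.sum_eq_zero fun ⟨i, j⟩ hij => ?_
        rw [Finset.HasAntidiagonal.mem_antidiagonal] at hij
        simp only at hij ⊢
        rcases lt_or_ge 1 i with hi | hi
        · rw [coeffAt_sub, X_eq, C_eq, coeffAt_monomialAt, coeffAt_monomialAt,
            if_neg hi.ne, if_neg (by omega), sub_zero, zero_mul]
        · simp [hdeg j (by omega)]
      · rcases Finset.mem_insert.1 hx with rfl | hx
        · refine ⟨(X - C (θ c * x * c⁻¹)) * u + C (θ c), ?_⟩
          rw [mul_assoc (X - _) p f, hu, mul_add, X_sub_C_mul_C _ _ hc, add_mul,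
            mul_assoc (X - _) u]
        · obtain ⟨v, hv⟩ := hdvd x hx
          exact ⟨(X - C (θ c * s * c⁻¹)) * v, by
            rw [mul_assoc (X - _) p f, hv, mul_assoc (X - _) v]⟩

theorem _root_.SkewGoppa.PIndependent.card_le_natDegree {S : Finset F} (hS : PIndependent θ S)
    {f : OrePoly θ} (hf : f ≠ 0) (h : ∀ s ∈ S, RightDvd (X - C s) f) : S.card ≤ f.natDegree := by
  obtain ⟨L, hL, hcard⟩ := hS
  obtain ⟨p, rfl⟩ := hL.2 f h
  have := natDegree_add_le_natDegree_mul (left_ne_zero_of_mul hf) (right_ne_zero_of_mul hf)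
  omega

/-- The truncated norm `N_i(s) = s θ(s) ⋯ θ^(i-1)(s)`. It is the remainder of `X^i` modulo
`X - s`. -/
def truncNorm (θ : F →+* F) (s : F) (i : ℕ) : F := ∏ l ∈ Finset.range i, (θ ^ l) s

theorem truncNorm_succ (s : F) (i : ℕ) :
    truncNorm θ s (i + 1) = truncNorm θ s i * (θ ^ i) s :=
  Finset.prod_range_succ _ _

theorem truncNorm_succ' (s : F) (i : ℕ) :
    truncNorm θ s (i + 1) = s * θ (truncNorm θ s i) := by
  rw [truncNorm, Finset.prod_range_succ', truncNorm, map_prod, mul_comm]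
  simp [pow_succ']

theorem truncNorm_ne_zero {s : F} (hs : s ≠ 0) (i : ℕ) : truncNorm θ s i ≠ 0 :=
  Finset.prod_ne_zero_iff.2 fun _ _ => (map_ne_zero _).2 hs

/-- The remainder theorem: evaluating through truncated norms gives the remainder modulo `X - s`. -/
theorem sum_coeffAt_mul_truncNorm {f u : OrePoly θ} {s c : F} (h : f = u * (X - C s) + C c)
    {n : ℕ} (hu : ∀ k, n ≤ k → coeffAt u k = 0) :
    ∑ i ∈ Finset.range (n + 1), coeffAt f i * truncNorm θ s i = c := by
  have key : ∀ m, ∑ i ∈ Finset.range (m + 1), coeffAt f i * truncNorm θ s i =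
      c - coeffAt u m * truncNorm θ s (m + 1) := by
    intro m
    induction m with
    | zero =>
      rw [zero_add, Finset.sum_range_one, h, coeffAt_add, coeffAt_mul_X_sub_C_zero, C_eq,
        coeffAt_monomialAt]
      simp [truncNorm]
      ring
    | succ m ih =>
      rw [Finset.sum_range_succ, ih, h, coeffAt_add, coeffAt_mul_X_sub_C_succ, C_eq,
        coeffAt_monomialAt, if_neg (by omega), truncNorm_succ s (m + 1)]
      ring
  rw [key, hu n le_rfl, zero_mul, sub_zero]

/-- The skew Vandermonde matrix of a P-independent set has independent columns: a polynomial
of degree `< |T|` can be found that vanishes on all but one point of `T`, as otherwise some nonzero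
polynomial of degree `< |S|` would vanish on the whole of `S`. -/
theorem _root_.SkewGoppa.PIndependent.eq_zero_of_sum_mul_truncNorm {S : Finset F}
    (hS : PIndependent θ S) {T : Finset F} (hT : T ⊆ S) {b : F → F}
    (hb : ∀ i < T.card, ∑ s ∈ T, b s * truncNorm θ s i = 0) {x : F} (hx : x ∈ T) : b x = 0 := by
  classical
  have hcard := Finset.card_erase_add_one hx
  obtain ⟨p, hp, hdeg, hdvd⟩ := exists_mul_ne_zero_forall_rightDvd (θ := θ) (f := 1) (by
      intro h
      have := congrArg (fun f => coeffAt f 0) h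
      simp [one_eq, coeffAt_monomialAt] at this) (m := 0)
    (fun k hk => by rw [one_eq, coeffAt_monomialAt, if_neg (by omega)]) (T.erase x)
  rw [mul_one] at hp hdvd
  simp only [mul_one, zero_add] at hdeg
  have hrem : ∀ s, ∃ c, ∑ i ∈ Finset.range T.card, coeffAt p i * truncNorm θ s i = c ∧
      (RightDvd (X - C s) p ↔ c = 0) := by
    intro s
    obtain ⟨u, c, hu, hu'⟩ := exists_eq_mul_X_sub_C_add_C s _ p hdeg
    have hc := sum_coeffAt_mul_truncNorm hu hu'
    rw [hcard] at hc
    refine ⟨c, hc, fun ⟨v, hv⟩ => ?_, ?_⟩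
    · have hv' : p = v * (X - C s) + C 0 := by rw [hv]; simp [C]
      set M := max v.natDegree (T.erase x).card
      have h1 := sum_coeffAt_mul_truncNorm hv' (n := M + 1)
        (fun k hk => coeffAt_eq_zero_of_natDegree_lt (by omega))
      have h2 := sum_coeffAt_mul_truncNorm hu (n := M + 1) (fun k hk => hu' k (by omega))
      exact h2.symm.trans h1
    · rintro rfl
      exact ⟨u, hu.trans (by simp [C])⟩
  have hzero : ∀ s ∈ T.erase x, ∑ i ∈ Finset.range T.card, coeffAt p i * truncNorm θ s i = 0 := by
    intro s hs
    obtain ⟨c, hc, hc'⟩ := hrem s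
    rw [hc, ← hc']
    exact hdvd s hs
  obtain ⟨c, hc, hc'⟩ := hrem x
  have hc0 : c ≠ 0 := by
    intro h0
    obtain ⟨p', hp', hdeg', hdvd'⟩ := exists_mul_ne_zero_forall_rightDvd hp hdeg (S \ T)
    have hle := hS.card_le_natDegree hp' (fun s hs => by
      by_cases hsT : s ∈ T
      · have hsp : RightDvd (X - C s) p := by
          rcases eq_or_ne s x with rfl | hsx
          · exact hc'.2 h0
          · exact hdvd s (Finset.mem_erase.2 ⟨hsx, hsT⟩)
        obtain ⟨v, hv⟩ := hsp
        exact ⟨p' * v, by rw [mul_assoc, ← hv]⟩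
      · exact hdvd' s (Finset.mem_sdiff.2 ⟨hs, hsT⟩))
    have := natDegree_le_of_coeffAt hdeg'
    have := Finset.card_sdiff_add_card_eq_card hT
    omega
  have h0 : ∑ i ∈ Finset.range T.card, coeffAt p i * ∑ s ∈ T, b s * truncNorm θ s i = 0 :=
    Finset.sum_eq_zero fun i hi => by rw [hb i (Finset.mem_range.1 hi), mul_zero]
  have h1 : ∑ s ∈ T, b s * ∑ i ∈ Finset.range T.card, coeffAt p i * truncNorm θ s i = 0 := by
    rw [← h0]
    simp_rw [Finset.mul_sum]
    rw [Finset.sum_comm]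
    exact Finset.sum_congr rfl fun i _ => Finset.sum_congr rfl fun s _ => by ring
  rw [Finset.sum_eq_single x (fun s hs hsx => by
    rw [hzero s (Finset.mem_erase.2 ⟨hsx, hs⟩), mul_zero]) (fun h => absurd hx h), hc] at h1
  exact (mul_eq_zero.1 h1).resolve_right hc0

/-! ### Inverses modulo an invariant polynomial -/

theorem not_isUnit_X_sub_C (s : F) : ¬ IsUnit (X - C s : OrePoly θ) := by
  intro h
  obtain ⟨v, hv⟩ := h.exists_left_inv
  have hv0 : v ≠ 0 := by
    rintro rfl
    have := congrArg (fun f => coeffAt f 0) hv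
    simp [one_eq, coeffAt_monomialAt] at this
  have := congrArg (fun f => coeffAt f (v.natDegree + 1)) hv
  simp only [coeffAt_mul_X_sub_C_succ, one_eq, coeffAt_monomialAt] at this
  rw [coeffAt_eq_zero_of_natDegree_lt (Nat.lt_succ_self _)] at this
  simp at this
  exact coeffAt_natDegree_ne_zero hv0 this

theorem inverseMod_spec {g : OrePoly θ} (hg : g ≠ 0) {s : F} (hs : RightCoprime (X - C s) g) :
    (inverseMod g s).degree < g.degree ∧ RightDvd g (inverseMod g s * (X - C s) - 1) := by
  refine Classical.epsilon_spec
    (p := fun h : OrePoly θ => h.degree < g.degree ∧ RightDvd g (h * (X - C s) - 1)) ?_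
  obtain ⟨u, c, hu, hdeg⟩ := exists_eq_mul_X_sub_C_add_C s g.natDegree g
    fun k hk => coeffAt_eq_zero_of_natDegree_lt hk
  have hc : c ≠ 0 := by
    rintro rfl
    exact not_isUnit_X_sub_C s (hs _ ⟨1, (one_mul _).symm⟩ ⟨u, hu.trans (by simp [C])⟩)
  refine ⟨C (-c⁻¹) * u, ?_, C (-c⁻¹), ?_⟩
  · rw [degree_eq_natDegree hg, degree_lt_iff]
    intro k hk
    rw [coeffAt_C_mul, hdeg k hk, mul_zero]
  · have hCC : (C (-c⁻¹) * C c : OrePoly θ) = -1 := by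
      refine ext_coeffAt fun k => ?_
      rw [coeffAt_C_mul, coeffAt_neg, C_eq, one_eq, coeffAt_monomialAt, coeffAt_monomialAt]
      split_ifs <;> simp [hc]
    conv_rhs => rw [hu, mul_add, hCC, ← mul_assoc]
    rw [sub_eq_add_neg]

/-- The coefficients of the inverse of `X - s` modulo `g`: since `h (X - s) - 1 = p g` with `p`
constant, they satisfy a two-term recurrence. -/
theorem exists_inverseMod_recurrence {g : OrePoly θ} (hg : g ≠ 0) {s : F}
    (hs : RightCoprime (X - C s) g) :
    (∀ k, g.natDegree ≤ k → coeffAt (inverseMod g s) k = 0) ∧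
    ∃ p : F, p ≠ 0 ∧ ∀ k, coeffAt (inverseMod g s) k =
      p * coeffAt g (k + 1) + coeffAt (inverseMod g s) (k + 1) * (θ ^ (k + 1)) s := by
  obtain ⟨hdeg, p, hp⟩ := inverseMod_spec hg hs
  set h := inverseMod g s
  rw [degree_eq_natDegree hg, degree_lt_iff] at hdeg
  refine ⟨hdeg, ?_⟩
  have hpC : p = C (coeffAt p 0) := by
    refine eq_C_of_natDegree_mul_le hg fun k hk => ?_
    obtain ⟨k, rfl⟩ : ∃ m, k = m + 1 := ⟨k - 1, by omega⟩
    rw [← hp, coeffAt_sub, coeffAt_mul_X_sub_C_succ, hdeg k (by omega), hdeg (k + 1) (by omega),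
      one_eq, coeffAt_monomialAt]
    simp
  refine ⟨coeffAt p 0, fun h0 => ?_, fun k => ?_⟩
  · rw [hpC, h0] at hp
    have h1 : h * (X - C s) = 1 := by
      rw [← sub_eq_zero, hp]
      simp [C]
    have hh : h ≠ 0 := by
      intro hh
      rw [hh, zero_mul] at h1
      have := congrArg (fun f => coeffAt f 0) h1
      simp [one_eq, coeffAt_monomialAt] at this
    have := congrArg (fun f => coeffAt f (h.natDegree + 1)) h1
    simp only [coeffAt_mul_X_sub_C_succ, one_eq, coeffAt_monomialAt] at this
    rw [coeffAt_eq_zero_of_natDegree_lt (Nat.lt_succ_self _)] at this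
    simp at this
    exact coeffAt_natDegree_ne_zero hh this
  · have := congrArg (fun f => coeffAt f (k + 1)) hp
    simp only [coeffAt_sub, coeffAt_mul_X_sub_C_succ] at this
    rw [hpC, coeffAt_C_mul, one_eq, coeffAt_monomialAt, if_neg (by omega), sub_zero] at this
    rw [← this]
    ring

/-- An invariant polynomial is, up to a scalar, a power of `X` times a central polynomial; this is
the part of that fact that is needed. -/
theorem Invariant.pow_apply_eq {g : OrePoly θ} (hg : g.Invariant) {i : ℕ} (hi : coeffAt g i ≠ 0)
    (a : F) : (θ ^ i) a = (θ ^ g.natDegree) a := by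
  obtain ⟨hg0, hg⟩ := hg
  obtain ⟨p, hp⟩ : g * C a ∈ {f : OrePoly θ | ∃ p, f = p * g} := hg ▸ ⟨C a, rfl⟩
  have hpC : p = C (coeffAt p 0) := by
    refine eq_C_of_natDegree_mul_le hg0 fun k hk => ?_
    rw [← hp, coeffAt_mul_C, coeffAt_eq_zero_of_natDegree_lt hk, zero_mul]
  have key : ∀ k, coeffAt g k ≠ 0 → (θ ^ k) a = coeffAt p 0 := by
    intro k hk
    have := congrArg (fun f => coeffAt f k) hp
    rw [hpC, coeffAt_C_mul, coeffAt_mul_C, mul_comm] at this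
    exact mul_right_cancel₀ hk this
  rw [key i hi, key _ (coeffAt_natDegree_ne_zero hg0)]

/-- The inverses of `X - s` modulo an invariant polynomial `g`, `s ∈ T`, are linearly independent
if `|T| ≤ deg g`. -/
theorem eq_zero_of_sum_mul_coeffAt_inverseMod (hθ : Function.Surjective θ) {S : Finset F}
    (hS0 : (0 : F) ∉ S) (hS : PIndependent θ (S.map ⟨fun s => s⁻¹, inv_injective⟩))
    {g : OrePoly θ} (hg : g.Invariant) (hco : ∀ s ∈ S, RightCoprime (X - C s) g)
    {T : Finset F} (hT : T ⊆ S) (hcard : T.card ≤ g.natDegree) {a : F → F}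
    (ha : ∀ k < g.natDegree, ∑ s ∈ T, a s * coeffAt (inverseMod g s) k = 0)
    {x : F} (hx : x ∈ T) : a x = 0 := by
  classical
  set d := g.natDegree with hd
  have hθi : ∀ n, Function.Injective (θ ^ n : F →+* F) := fun n => RingHom.injective _
  have hgd : coeffAt g d ≠ 0 := coeffAt_natDegree_ne_zero hg.1
  have hs0 : ∀ s ∈ T, s ≠ 0 := fun s hs h => hS0 (h ▸ hT hs)
  have hrec : ∀ s, ∃ p : F, s ∈ S → p ≠ 0 ∧ ∀ k, coeffAt (inverseMod g s) k =
      p * coeffAt g (k + 1) + coeffAt (inverseMod g s) (k + 1) * (θ ^ (k + 1)) s := by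
    intro s
    by_cases hs : s ∈ S
    · obtain ⟨p, hp⟩ := (exists_inverseMod_recurrence hg.1 (hco s hs)).2
      exact ⟨p, fun _ => hp⟩
    · exact ⟨0, fun h => absurd h hs⟩
  choose p hp using hrec
  -- The products `θ^(d-1)(s) ⋯ θ^(d-j)(s)`.
  let D : ℕ → F → F := fun j s => ∏ l ∈ Finset.range j, (θ ^ (d - 1 - l)) s
  have hform : ∀ s ∈ T, ∀ j < d, coeffAt (inverseMod g s) (d - 1 - j) =
      p s * ∑ l ∈ Finset.range (j + 1), coeffAt g (d - j + l) * D l s := by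
    intro s hs j
    have hvan := (exists_inverseMod_recurrence hg.1 (hco s (hT hs))).1
    induction j with
    | zero =>
      intro hj
      rw [(hp s (hT hs)).2, show d - 1 - 0 + 1 = d by omega, hvan d le_rfl]
      simp [D]
    | succ j ih =>
      intro hj
      rw [(hp s (hT hs)).2, show d - 1 - (j + 1) + 1 = d - 1 - j by omega, ih (by omega),
        Finset.sum_range_succ' _ (j + 1), mul_add, add_comm, mul_assoc, Finset.sum_mul,
        show d - (j + 1) + 0 = d - 1 - j by omega]
      congr 1
      · congr 1
        refine Finset.sum_congr rfl fun l hl => ?_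
        rw [Finset.mem_range] at hl
        rw [show d - (j + 1) + (l + 1) = d - j + l by omega, mul_assoc]
        by_cases h0 : coeffAt g (d - j + l) = 0
        · rw [h0, zero_mul, zero_mul]
        · -- Invariance of `g` is what makes the coefficients a triangular transform of `D`.
          congr 1
          simp only [D]
          rw [Finset.prod_range_succ]
          congr 1
          apply hθi (l + 1)
          rw [← pow_add_apply, ← pow_add_apply,
            show l + 1 + (d - 1 - j) = d - j + l by omega,
            show l + 1 + (d - 1 - l) = d by omega]
          exact hg.pow_apply_eq h0 s
      · simp [D]
  have hD : ∀ j < d, ∑ s ∈ T, a s * p s * D j s = 0 := by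
    intro j
    induction j using Nat.strong_induction_on with
    | _ j ih =>
      intro hj
      have h1 := ha (d - 1 - j) (by omega)
      have h2 : ∑ s ∈ T, a s * coeffAt (inverseMod g s) (d - 1 - j) =
          ∑ l ∈ Finset.range (j + 1), coeffAt g (d - j + l) * ∑ s ∈ T, a s * p s * D l s := by
        simp_rw [Finset.mul_sum]
        rw [Finset.sum_comm]
        refine Finset.sum_congr rfl fun s hs => ?_
        rw [hform s hs j hj, Finset.mul_sum, Finset.mul_sum]
        exact Finset.sum_congr rfl fun l _ => by ring
      rw [h2, Finset.sum_range_succ, Finset.sum_eq_zero (fun l hl => by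
        rw [Finset.mem_range] at hl
        rw [ih l hl (by omega), mul_zero]), zero_add, show d - j + j = d by omega] at h1
      exact (mul_eq_zero.1 h1).resolve_left hgd
  have hDN : ∀ s ∈ T, ∀ j ≤ d, D j s = truncNorm θ s d * truncNorm θ s⁻¹ (d - j) := by
    intro s hs j
    induction j with
    | zero =>
      intro _
      have : ∀ n, truncNorm θ s n * truncNorm θ s⁻¹ n = 1 := by
        intro n
        rw [truncNorm, truncNorm, ← Finset.prod_mul_distrib]
        refine Finset.prod_eq_one fun l _ => ?_
        rw [← map_mul, mul_inv_cancel₀ (hs0 s hs), map_one]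
      rw [Nat.sub_zero, this]
      simp [D]
    | succ j ih =>
      intro hj
      have h1 := ih (by omega)
      have hne : (θ ^ (d - 1 - j)) s ≠ 0 := (map_ne_zero _).2 (hs0 s hs)
      rw [show d - j = d - 1 - j + 1 by omega, truncNorm_succ, map_inv₀] at h1
      simp only [D] at h1 ⊢
      rw [Finset.prod_range_succ, h1, show d - (j + 1) = d - 1 - j by omega]
      field_simp
  choose e he using fun s => hθ (a s * p s * truncNorm θ s d * s⁻¹)
  have hE : ∀ i < d, ∑ s ∈ T, e s * truncNorm θ s⁻¹ i = 0 := by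
    intro i hi
    apply θ.injective
    rw [map_zero, map_sum, ← hD (d - 1 - i) (by omega)]
    refine Finset.sum_congr rfl fun s hs => ?_
    rw [map_mul, he, hDN s hs _ (by omega), show d - (d - 1 - i) = i + 1 by omega,
      truncNorm_succ']
    ring
  have hsub : T.map ⟨fun s => s⁻¹, inv_injective⟩ ⊆ S.map ⟨fun s => s⁻¹, inv_injective⟩ :=
    Finset.map_subset_map.2 hT
  have hex : e x = 0 := by
    have := hS.eq_zero_of_sum_mul_truncNorm hsub (b := fun s => e s⁻¹) (x := x⁻¹) (by
      intro i hi
      rw [Finset.card_map] at hi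
      rw [Finset.sum_map]
      simpa using hE i (by omega)) (Finset.mem_map_of_mem ⟨fun s => s⁻¹, inv_injective⟩ hx)
    simpa using this
  have hfin := he x
  rw [hex, map_zero] at hfin
  simpa [(hp x (hT hx)).1, truncNorm_ne_zero (hs0 x hx), hs0 x hx] using hfin.symm

end OrePoly

/-! ### Inverses of linear polynomials in the commutative variables -/

section Commutative

open Polynomial

variable {F : Type*} [Field F]

theorem inverseMod_spec {g : F[X]} {s : F} (hs : g.eval s ≠ 0) :
    (inverseMod g s).degree < g.degree ∧ g ∣ inverseMod g s * (X - C s) - 1 := by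
  refine Classical.epsilon_spec
    (p := fun h : F[X] => h.degree < g.degree ∧ g ∣ h * (X - C s) - 1) ?_
  have hg : g ≠ 0 := by rintro rfl; simp at hs
  have hdiv := modByMonic_add_div g (X - C s)
  rw [modByMonic_X_sub_C_eq_C_eval] at hdiv
  refine ⟨C (-(g.eval s)⁻¹) * (g /ₘ (X - C s)), ?_, C (-(g.eval s)⁻¹), ?_⟩
  · rw [degree_C_mul (by simpa using hs)]
    exact degree_divByMonic_lt _ _ hg (by rw [degree_X_sub_C]; exact zero_lt_one)
  · have hc : C (-(g.eval s)⁻¹) * C (g.eval s) = (-1 : F[X]) := by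
      rw [← C_mul, neg_mul, inv_mul_cancel₀ hs, C_neg, C_1]
    linear_combination C (-(g.eval s)⁻¹) * hdiv - hc

/-- The inverses of `X - s` modulo `g`, `s ∈ T`, are linearly independent if `|T| ≤ deg g`: clearing
denominators in a relation gives a multiple of `g` of degree `< |T|`. -/
theorem eq_zero_of_sum_mul_coeff_inverseMod {g : F[X]} {T : Finset F}
    (hT : ∀ s ∈ T, g.eval s ≠ 0) (hcard : T.card ≤ g.natDegree) {a : F → F}
    (ha : ∀ k < g.natDegree, ∑ s ∈ T, a s * (inverseMod g s).coeff k = 0) {x : F} (hx : x ∈ T) :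
    a x = 0 := by
  classical
  have hg : g ≠ 0 := by rintro rfl; simpa using hT x hx
  have hsum : ∑ s ∈ T, C (a s) * inverseMod g s = 0 := by
    ext k
    simp only [finsetSum_coeff, coeff_C_mul, coeff_zero]
    rcases lt_or_ge k g.natDegree with hk | hk
    · exact ha k hk
    · refine Finset.sum_eq_zero fun s hs => ?_
      rw [coeff_eq_zero_of_degree_lt, mul_zero]
      refine (inverseMod_spec (hT s hs)).1.trans_le ?_
      rw [degree_eq_natDegree hg]
      exact_mod_cast hk
  have hdvd : g ∣ ∑ s ∈ T, C (a s) * ∏ y ∈ T.erase s, (X - C y) := by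
    have h1 : ∑ s ∈ T, C (a s) * ∏ y ∈ T.erase s, (X - C y) =
        ∑ s ∈ T, -(C (a s) * ∏ y ∈ T.erase s, (X - C y)) * (inverseMod g s * (X - C s) - 1) := by
      have h2 : (∑ s ∈ T, C (a s) * inverseMod g s) * ∏ y ∈ T, (X - C y) = 0 := by
        rw [hsum, zero_mul]
      rw [← sub_eq_zero, ← Finset.sum_sub_distrib, ← h2, Finset.sum_mul]
      refine Finset.sum_congr rfl fun s hs => ?_
      rw [← Finset.mul_prod_erase T _ hs]
      ring
    rw [h1]
    exact Finset.dvd_sum fun s hs => Dvd.dvd.mul_left (inverseMod_spec (hT s hs)).2 _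
  have hdeg : (∑ s ∈ T, C (a s) * ∏ y ∈ T.erase s, (X - C y)).degree < g.degree := by
    rw [degree_eq_natDegree hg]
    refine (degree_sum_le _ _).trans_lt ((Finset.sup_lt_iff (WithBot.bot_lt_coe _)).2
      fun s hs => ?_)
    rw [← smul_eq_C_mul]
    refine (degree_smul_le _ _).trans_lt ?_
    rw [degree_prod]
    simp only [degree_X_sub_C, Finset.sum_const, nsmul_eq_mul, mul_one]
    have := Finset.card_erase_lt_of_mem hs
    exact_mod_cast this.trans_le hcard
  have h0 := congrArg (eval x) (eq_zero_of_dvd_of_degree_lt hdvd hdeg)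
  rw [eval_finsetSum, Finset.sum_eq_single x, eval_mul, eval_C, eval_prod, eval_zero] at h0
  · refine (mul_eq_zero.1 h0).resolve_right (Finset.prod_ne_zero_iff.2 fun y hy => ?_)
    simpa [sub_eq_zero] using (Finset.mem_erase.1 hy).1.symm
  · intro s _ hsx
    rw [eval_mul, eval_prod, Finset.prod_eq_zero (Finset.mem_erase.2 ⟨hsx.symm, hx⟩) (by simp),
      mul_zero]
  · exact fun h => absurd hx h

end Commutative

/-! ### Products of independent families -/

section Tensor

variable {F : Type*} [Field F]

/-- A linearly independent family has a dual family with respect to the standard pairing. -/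
theorem exists_dual_family {σ κ : Type*} [Fintype κ] [DecidableEq σ] {v : σ → κ → F} {T : Finset σ}
    (h : ∀ a : σ → F, (∀ k, ∑ s ∈ T, a s * v s k = 0) → ∀ s ∈ T, a s = 0) :
    ∃ w : σ → κ → F, ∀ s ∈ T, ∀ s' ∈ T, ∑ k, w s k * v s' k = if s = s' then 1 else 0 := by
  classical
  let L : (T → F) →ₗ[F] (κ → F) := Fintype.linearCombination F (fun s : T => v s)
  have hL : LinearMap.ker L = ⊥ := by
    rw [LinearMap.ker_eq_bot']
    intro b hb
    funext ⟨s, hs⟩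
    have := h (fun s => if hs : s ∈ T then b ⟨s, hs⟩ else 0) (fun k => by
      have hk := congrFun hb k
      simp only [L, Fintype.linearCombination_apply, Finset.sum_apply, Pi.smul_apply, smul_eq_mul,
        Pi.zero_apply] at hk
      rw [← Finset.sum_coe_sort, ← hk]
      exact Finset.sum_congr rfl fun s _ => by simp) s hs
    simpa [hs] using this
  obtain ⟨r, hr⟩ := L.exists_leftInverse_of_injective hL
  refine ⟨fun s k => if hs : s ∈ T then r (Pi.single k 1) ⟨s, hs⟩ else 0, fun s hs s' hs' => ?_⟩
  have h1 : r (v s') = Pi.single ⟨s', hs'⟩ 1 := by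
    have h2 := LinearMap.congr_fun hr (Pi.single ⟨s', hs'⟩ 1)
    simpa [L] using h2
  have h3 := congrFun h1 ⟨s, hs⟩
  rw [LinearMap.pi_apply_eq_sum_univ r (v s')] at h3
  simp only [Finset.sum_apply, Pi.smul_apply, smul_eq_mul, Pi.single_apply, Subtype.mk.injEq] at h3
  rw [← h3]
  refine Finset.sum_congr rfl fun k _ => ?_
  simp only [hs, dif_pos]
  rw [mul_comm]
  congr 2
  refine congrArg (fun y => r y ⟨s, hs⟩) (funext fun k' => ?_)
  simp [Pi.single_apply, eq_comm]

variable {ι : Type*} [Fintype ι] [DecidableEq ι] {σ : ι → Type*} {d : ι → ℕ}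

/-- Tensor products of independent families are independent. -/
theorem eq_zero_of_sum_piFinset_mul_prod {v : ∀ i, σ i → Fin (d i) → F} {T : ∀ i, Finset (σ i)}
    (hv : ∀ i, ∀ a : σ i → F, (∀ k, ∑ s ∈ T i, a s * v i s k = 0) → ∀ s ∈ T i, a s = 0)
    {c : (∀ i, σ i) → F}
    (hc : ∀ u : ∀ i, Fin (d i), ∑ j ∈ Fintype.piFinset T, c j * ∏ i, v i (j i) (u i) = 0)
    {x : ∀ i, σ i} (hx : x ∈ Fintype.piFinset T) : c x = 0 := by
  classical
  choose w hw using fun i => exists_dual_family (hv i)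
  have hx' := fun i => Fintype.mem_piFinset.1 hx i
  have key : ∀ j ∈ Fintype.piFinset T,
      ∑ u : ∀ i, Fin (d i), (∏ i, w i (x i) (u i)) * ∏ i, v i (j i) (u i) =
        if x = j then 1 else 0 := by
    intro j hj
    have hj' := fun i => Fintype.mem_piFinset.1 hj i
    simp_rw [← Finset.prod_mul_distrib]
    rw [← Fintype.piFinset_univ, ← Finset.prod_univ_sum (fun _ => Finset.univ)
      (fun i k => w i (x i) k * v i (j i) k)]
    simp_rw [fun i => hw i (x i) (hx' i) (j i) (hj' i)]
    split_ifs with h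
    · subst h; simp
    · obtain ⟨i, hi⟩ := Function.ne_iff.1 h
      exact Finset.prod_eq_zero (Finset.mem_univ i) (if_neg hi)
  have h0 : ∑ u : ∀ i, Fin (d i), (∏ i, w i (x i) (u i)) *
      ∑ j ∈ Fintype.piFinset T, c j * ∏ i, v i (j i) (u i) = 0 :=
    Finset.sum_eq_zero fun u _ => by rw [hc, mul_zero]
  have h1 : ∑ j ∈ Fintype.piFinset T, c j * ∑ u : ∀ i, Fin (d i),
      (∏ i, w i (x i) (u i)) * ∏ i, v i (j i) (u i) = 0 := by
    rw [← h0]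
    simp_rw [Finset.mul_sum]
    rw [Finset.sum_comm]
    exact Finset.sum_congr rfl fun u _ => Finset.sum_congr rfl fun j _ => by ring
  rw [Finset.sum_congr rfl fun j hj => by rw [key j hj]] at h1
  simpa [hx] using h1

variable [∀ i, Fintype (σ i)] {E : Type*} [Field E] [Algebra E F]

variable {v : ∀ i, σ i → Fin (d i) → F} {η : (∀ i, σ i) → Fˣ} {A : Submodule E ((∀ i, σ i) → E)}

/-- A codeword supported on a box `∏ T i` with `|T i| ≤ d i` vanishes. -/
theorem codeword_eq_zero_of_support
    (hv : ∀ i, ∀ T : Finset (σ i), T.card ≤ d i → ∀ a : σ i → F,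
      (∀ k, ∑ s ∈ T, a s * v i s k = 0) → ∀ s ∈ T, a s = 0)
    (hA : ∀ c, c ∈ A ↔ ∀ u : ∀ i, Fin (d i),
      ∑ j, (algebraMap E F (c j) * (η j : F)) * ∏ i, v i (j i) (u i) = 0)
    {c : (∀ i, σ i) → E} (hc : c ∈ A) (T : ∀ i, Finset (σ i)) (hT : ∀ i, (T i).card ≤ d i)
    (hsupp : ∀ j, c j ≠ 0 → j ∈ Fintype.piFinset T) : c = 0 := by
  classical
  funext x
  by_contra hx
  have h0 := eq_zero_of_sum_piFinset_mul_prod (v := v) (T := T) (fun i => hv i (T i) (hT i))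
    (c := fun j => algebraMap E F (c j) * (η j : F)) (fun u => by
      rw [← (hA c).1 hc u]
      refine Finset.sum_subset (Finset.subset_univ _) fun j _ hj => ?_
      rw [not_not.1 fun h => hj (hsupp j h)]
      simp) (hsupp x hx)
  simp at h0
  exact hx h0

/-- The code is cut out by `∏ d i` parity checks over `F`, each worth `[F : E]` checks over `E`. -/
theorem le_finrank_code [FiniteDimensional E F]
    (hA : ∀ c, c ∈ A ↔ ∀ u : ∀ i, Fin (d i),
      ∑ j, (algebraMap E F (c j) * (η j : F)) * ∏ i, v i (j i) (u i) = 0) :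
    Fintype.card (∀ i, σ i) ≤ Module.finrank E A + (∏ i, d i) * Module.finrank E F := by
  let Φ : ((∀ i, σ i) → E) →ₗ[E] ((∀ i, Fin (d i)) → F) :=
    { toFun := fun c u => ∑ j, (algebraMap E F (c j) * (η j : F)) * ∏ i, v i (j i) (u i)
      map_add' := fun c c' => by
        funext u
        simp [add_mul, Finset.sum_add_distrib]
      map_smul' := fun a c => by
        funext u
        simp [Finset.mul_sum, Algebra.smul_def, mul_assoc] }
  have hker : LinearMap.ker Φ = A := by
    ext c
    rw [LinearMap.mem_ker, hA]
    exact funext_iff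
  have h1 := LinearMap.finrank_range_add_finrank_ker Φ
  have h2 : Module.finrank E (LinearMap.range Φ) ≤ Module.finrank E ((∀ i, Fin (d i)) → F) :=
    Submodule.finrank_le _
  rw [Module.finrank_pi_fintype] at h2
  rw [hker, Module.finrank_fintype_fun_eq_card] at h1
  simp at h2
  omega

/-- The code meets the vectors supported on a box with `d i` points in each direction trivially. -/
theorem finrank_code_add_prod_le
    (hv : ∀ i, ∀ T : Finset (σ i), T.card ≤ d i → ∀ a : σ i → F,
      (∀ k, ∑ s ∈ T, a s * v i s k = 0) → ∀ s ∈ T, a s = 0)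
    (hA : ∀ c, c ∈ A ↔ ∀ u : ∀ i, Fin (d i),
      ∑ j, (algebraMap E F (c j) * (η j : F)) * ∏ i, v i (j i) (u i) = 0)
    (hd : ∀ i, d i ≤ Fintype.card (σ i)) :
    Module.finrank E A + ∏ i, d i ≤ Fintype.card (∀ i, σ i) := by
  classical
  choose T _ hT using fun i => Finset.exists_subset_card_eq (s := (Finset.univ : Finset (σ i)))
    (n := d i) (by simpa using hd i)
  -- Restriction to the complement of the box `∏ T i` is injective on the code.
  let ρ : ((∀ i, σ i) → E) →ₗ[E] ({j // j ∉ Fintype.piFinset T} → E) :=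
    LinearMap.funLeft E E Subtype.val
  have hinj : Function.Injective (ρ.comp A.subtype) := by
    rw [← LinearMap.ker_eq_bot, LinearMap.ker_eq_bot']
    rintro ⟨c, hc⟩ h
    refine Subtype.ext (codeword_eq_zero_of_support hv hA hc T (fun i => (hT i).le) fun j hj => ?_)
    by_contra hjT
    exact hj (congrFun h ⟨j, hjT⟩)
  have h1 := LinearMap.finrank_le_finrank_of_injective hinj
  have h2 := Fintype.card_subtype_compl (fun j => j ∈ Fintype.piFinset T)
  rw [Fintype.card_coe, Fintype.card_piFinset] at h2
  simp_rw [hT] at h2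
  rw [Module.finrank_fintype_fun_eq_card, h2] at h1
  have h3 : ∏ i, d i ≤ Fintype.card (∀ i, σ i) := by
    rw [Fintype.card_pi]
    exact Finset.prod_le_prod' fun i _ => hd i
  omega

/-- A codeword of weight at most `min d i` is supported on the box spanned by the coordinate
projections of its support. -/
theorem iInf_le_minDist_code
    (hv : ∀ i, ∀ T : Finset (σ i), T.card ≤ d i → ∀ a : σ i → F,
      (∀ k, ∑ s ∈ T, a s * v i s k = 0) → ∀ s ∈ T, a s = 0)
    (hA : ∀ c, c ∈ A ↔ ∀ u : ∀ i, Fin (d i),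
      ∑ j, (algebraMap E F (c j) * (η j : F)) * ∏ i, v i (j i) (u i) = 0) :
    ⨅ i, ((d i : ℕ∞) + 1) ≤ minDist A := by
  classical
  refine le_iInf₂ fun c hc => le_iInf fun hc0 => ?_
  by_contra! hlt
  refine hc0 (codeword_eq_zero_of_support hv hA hc
    (fun i => (Finset.univ.filter fun j => c j ≠ 0).image fun j => j i) (fun i => ?_)
    fun j hj => ?_)
  · refine Finset.card_image_le.trans ?_
    have h1 := hlt.trans_le (iInf_le _ i)
    have h2 : hammingNorm c < d i + 1 := by
      convert (by exact_mod_cast h1 : hammingNorm c < d i + 1)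
    exact Nat.lt_succ_iff.1 (by simpa only [hammingNorm] using h2)
  · exact Fintype.mem_piFinset.2 fun i =>
      Finset.mem_image_of_mem _ (Finset.mem_filter.2 ⟨Finset.mem_univ _, hj⟩)

end Tensor

/-! ### Coefficients in the multivariate Ore polynomial ring -/

namespace MvOrePoly

variable {F : Type*} [Field F] {θ : F →+* F} {ℓ : ℕ}

/-- The coefficient of `X^u`, scalars being written on the left. -/
def coeffAt (f : MvOrePoly θ ℓ) (u : Fin (ℓ + 1) →₀ ℕ) : F := f.coeff (OreMonoid.mk θ _ u)

theorem ext_coeffAt {f g : MvOrePoly θ ℓ} (h : ∀ u, coeffAt f u = coeffAt g u) : f = g :=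
  SkewMonoidAlgebra.ext h

/-- The coefficient of `X^u` as a linear functional. -/
def lcoeffAt (θ : F →+* F) (u : Fin (ℓ + 1) →₀ ℕ) : MvOrePoly θ ℓ →ₗ[F] F where
  toFun f := coeffAt f u
  map_add' f g := by simp [coeffAt]
  map_smul' a f := by simp [coeffAt]

theorem coeffAt_sum {ι : Type*} (s : Finset ι) (f : ι → MvOrePoly θ ℓ) (u : Fin (ℓ + 1) →₀ ℕ) :
    coeffAt (∑ i ∈ s, f i) u = ∑ i ∈ s, coeffAt (f i) u :=
  map_sum (lcoeffAt θ u) f s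

theorem coeffAt_smul (a : F) (f : MvOrePoly θ ℓ) (u : Fin (ℓ + 1) →₀ ℕ) :
    coeffAt (a • f) u = a * coeffAt f u :=
  (lcoeffAt θ u).map_smul a f

theorem coeffAt_monomial (i : Fin (ℓ + 1)) (k : ℕ) (a : F) (u : Fin (ℓ + 1) →₀ ℕ) :
    coeffAt (monomial i k a : MvOrePoly θ ℓ) u = if Finsupp.single i k = u then a else 0 :=
  SkewMonoidAlgebra.coeff_single_apply (k := F) (G := Multiplicative (Fin (ℓ + 1) →₀ ℕ))

/-- Multiplication by a power of a variable that commutes with the scalars shifts coefficients. -/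
theorem coeffAt_monomial_castSucc_mul (i : Fin ℓ) (k : ℕ) (a : F) (f : MvOrePoly θ ℓ)
    (u : Fin (ℓ + 1) →₀ ℕ) :
    coeffAt (monomial i.castSucc k a * f) u =
      if k ≤ u i.castSucc then a * coeffAt f (u - Finsupp.single i.castSucc k) else 0 := by
  split_ifs with hk
  · have hle : Finsupp.single i.castSucc k ≤ u := by simpa using hk
    refine (SkewMonoidAlgebra.coeff_single_mul_aux f (r := a) (fun w => ?_)
      (z := OreMonoid.mk θ _ (u - Finsupp.single i.castSucc k))).trans ?_
    · change (Finsupp.single i.castSucc k + (w.exponent : Fin (ℓ + 1) →₀ ℕ) = u ↔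
        (w.exponent : Fin (ℓ + 1) →₀ ℕ) = u - Finsupp.single i.castSucc k)
      exact ⟨fun h => by rw [← h, add_tsub_cancel_left], fun h => by
        rw [h, add_tsub_cancel_of_le hle]⟩
    · congr 1
      change (θ ^ (Finsupp.single i.castSucc k (Fin.last ℓ))) _ = _
      rw [Finsupp.single_eq_of_ne (Fin.castSucc_lt_last i).ne', pow_zero]
      rfl
  · refine SkewMonoidAlgebra.coeff_single_mul_of_not_exists_mul a f ?_
    rintro ⟨w, hw⟩
    apply hk
    have hw' : u = Finsupp.single i.castSucc k + (w.exponent : Fin (ℓ + 1) →₀ ℕ) := hw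
    rw [hw']
    simp

theorem coeffAt_ofPolynomial_mul (i : Fin ℓ) (p : Polynomial F) {f : MvOrePoly θ ℓ}
    (hf : ∀ u, u i.castSucc ≠ 0 → coeffAt f u = 0) (u : Fin (ℓ + 1) →₀ ℕ) :
    coeffAt (ofPolynomial θ i p * f) u =
      p.coeff (u i.castSucc) * coeffAt f (u.erase i.castSucc) := by
  rw [ofPolynomial, Polynomial.sum_def, Finset.sum_mul, coeffAt_sum,
    Finset.sum_eq_single (u i.castSucc)]
  · rw [coeffAt_monomial_castSucc_mul, if_pos le_rfl]
    congr 2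
    ext y
    rcases eq_or_ne y i.castSucc with rfl | hy
    · simp
    · simp [hy]
  · intro k _ hk
    rw [coeffAt_monomial_castSucc_mul]
    split_ifs with hle
    · rw [hf, mul_zero]
      simp
      omega
    · rfl
  · intro h
    rw [Polynomial.notMem_support_iff.1 h, coeffAt_monomial_castSucc_mul]
    simp

theorem coeffAt_ofOrePoly (f : OrePoly θ) (u : Fin (ℓ + 1) →₀ ℕ) :
    coeffAt (ofOrePoly ℓ f) u =
      if ∀ i : Fin ℓ, u i.castSucc = 0 then f.coeffAt (u (Fin.last ℓ)) else 0 := by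
  rw [ofOrePoly, SkewMonoidAlgebra.sum_def', coeffAt_sum]
  simp_rw [coeffAt_monomial]
  split_ifs with h
  · have hu : u = Finsupp.single (Fin.last ℓ) (u (Fin.last ℓ)) := by
      ext y
      refine Fin.lastCases (by simp) (fun i => ?_) y
      rw [h i, Finsupp.single_eq_of_ne (Fin.castSucc_lt_last i).ne]
    rw [Finset.sum_eq_single (OreMonoid.mk θ (AddMonoidHom.id ℕ) (u (Fin.last ℓ)))]
    · exact if_pos hu.symm
    · intro w _ hw
      refine if_neg fun h' => hw ?_
      rw [← h', Finsupp.single_eq_same]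
      rfl
    · intro hw
      rw [SkewMonoidAlgebra.notMem_support_iff.1 hw, ite_self]
  · refine Finset.sum_eq_zero fun w _ => if_neg fun h' => h fun i => ?_
    rw [← h', Finsupp.single_eq_of_ne (Fin.castSucc_lt_last i).ne]

theorem coeffAt_list_prod_mul_ofOrePoly (p : Fin ℓ → Polynomial F) (f : OrePoly θ)
    (l : List (Fin ℓ)) (hl : l.Nodup) (u : Fin (ℓ + 1) →₀ ℕ) :
    coeffAt ((l.map fun i => ofPolynomial θ i (p i)).prod * ofOrePoly ℓ f) u =
      if ∀ i ∉ l, u i.castSucc = 0 then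
        (l.map fun i => (p i).coeff (u i.castSucc)).prod * f.coeffAt (u (Fin.last ℓ)) else 0 := by
  induction l generalizing u with
  | nil => simp [coeffAt_ofOrePoly]
  | cons i l ih =>
    obtain ⟨hi, hl⟩ := List.nodup_cons.1 hl
    rw [List.map_cons, List.prod_cons, mul_assoc, coeffAt_ofPolynomial_mul i (p i) fun u hu => by
      rw [ih hl, if_neg fun h => hu (h i hi)], ih hl, List.map_cons, List.prod_cons]
    have hcond : (∀ y ∉ l, u.erase i.castSucc y.castSucc = 0) ↔
        ∀ y ∉ i :: l, u y.castSucc = 0 := by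
      constructor
      · intro h y hy
        rw [List.mem_cons, not_or] at hy
        rw [← h y hy.2, Finsupp.erase_ne (by simpa using hy.1)]
      · intro h y hy
        rcases eq_or_ne y i with rfl | hyi
        · simp
        · rw [Finsupp.erase_ne (by simpa using hyi)]
          exact h y (by simp [hyi, hy])
    have hmap : (l.map fun y => (p y).coeff (u.erase i.castSucc y.castSucc)) =
        l.map fun y => (p y).coeff (u y.castSucc) :=
      List.map_congr_left fun y hy => by
        rw [Finsupp.erase_ne]
        rintro h
        exact hi (Fin.castSucc_injective _ h ▸ hy)
    rw [hmap, Finsupp.erase_ne (Fin.castSucc_lt_last i).ne']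
    simp only [hcond]
    split_ifs <;> ring

end MvOrePoly

/-! ### The parity checks of the Goppa code -/

section Goppa

variable {F : Type*} [Field F] {θ : F →+* F} {ℓ : ℕ}

/-- The coefficient of `X_i^k` in the inverse of `X_i - s` modulo `g_i`. -/
def inverseCoeff (g : Fin ℓ → Polynomial F) (gLast : OrePoly θ) (i : Fin (ℓ + 1)) (s : F) (k : ℕ) :
    F :=
  Fin.snoc (α := fun _ => F) (fun i => (inverseMod (g i) s).coeff k)
    ((OrePoly.inverseMod gLast s).coeffAt k) i

/-- The coefficients of `h_j` are products: the twist `θ` does not intervene, as the factor in the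
last variable stands on the right, so that its coefficients only move past variables commuting with
the scalars. -/
theorem coeffAt_goppaPoly (g : Fin ℓ → Polynomial F) (gLast : OrePoly θ) (j : Fin (ℓ + 1) → F)
    (u : Fin (ℓ + 1) →₀ ℕ) :
    MvOrePoly.coeffAt (goppaPoly g gLast j) u = ∏ i, inverseCoeff g gLast i (j i) (u i) := by
  rw [goppaPoly, List.ofFn_eq_map, MvOrePoly.coeffAt_list_prod_mul_ofOrePoly
    (fun i => inverseMod (g i) (j i.castSucc)) _ _ (List.nodup_finRange ℓ),
    if_pos fun i hi => absurd (List.mem_finRange i) hi, ← List.ofFn_eq_map, List.prod_ofFn,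
    Fin.prod_univ_castSucc]
  simp [inverseCoeff]

theorem inverseCoeff_eq_zero_of_le {g : Fin ℓ → Polynomial F} {gLast : OrePoly θ}
    {S : Fin (ℓ + 1) → Finset F} (hg : ∀ i, ∀ s ∈ S i.castSucc, (g i).eval s ≠ 0)
    (hgLast : gLast ≠ 0)
    (hco : ∀ s ∈ S (Fin.last ℓ), OrePoly.RightCoprime (OrePoly.X - OrePoly.C s) gLast)
    (i : Fin (ℓ + 1)) {s : F} (hs : s ∈ S i) {k : ℕ} (hk : goppaDegrees g gLast i ≤ k) :
    inverseCoeff g gLast i s k = 0 := by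
  induction i using Fin.lastCases with
  | last =>
    simp only [inverseCoeff, goppaDegrees, Fin.snoc_last] at hk ⊢
    exact (OrePoly.exists_inverseMod_recurrence hgLast (hco s hs)).1 k hk
  | cast i =>
    simp only [inverseCoeff, goppaDegrees, Fin.snoc_castSucc] at hk ⊢
    refine Polynomial.coeff_eq_zero_of_degree_lt ((inverseMod_spec (hg i s hs)).1.trans_le ?_)
    exact Polynomial.degree_le_of_natDegree_le hk

theorem eq_zero_of_sum_mul_inverseCoeff (hθ : Function.Surjective θ)
    {g : Fin ℓ → Polynomial F} {gLast : OrePoly θ}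
    {S : Fin (ℓ + 1) → Finset F} (hS0 : (0 : F) ∉ S (Fin.last ℓ))
    (hS : PIndependent θ ((S (Fin.last ℓ)).map ⟨fun s => s⁻¹, inv_injective⟩))
    (hg : ∀ i, ∀ s ∈ S i.castSucc, (g i).eval s ≠ 0) (hgLast : gLast.Invariant)
    (hco : ∀ s ∈ S (Fin.last ℓ), OrePoly.RightCoprime (OrePoly.X - OrePoly.C s) gLast)
    (i : Fin (ℓ + 1)) {T : Finset F} (hT : T ⊆ S i) (hcard : T.card ≤ goppaDegrees g gLast i)
    {a : F → F}
    (ha : ∀ k < goppaDegrees g gLast i, ∑ s ∈ T, a s * inverseCoeff g gLast i s k = 0)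
    {x : F} (hx : x ∈ T) : a x = 0 := by
  induction i using Fin.lastCases with
  | last =>
    simp only [inverseCoeff, goppaDegrees, Fin.snoc_last] at hcard ha
    exact OrePoly.eq_zero_of_sum_mul_coeffAt_inverseMod hθ hS0 hS hgLast hco hT hcard ha hx
  | cast i =>
    simp only [inverseCoeff, goppaDegrees, Fin.snoc_castSucc] at hcard ha
    exact eq_zero_of_sum_mul_coeff_inverseMod (fun s hs => hg i s (hT hs)) hcard ha hx

theorem mem_gsmgCode_iff {E : Type*} [Field E] [Algebra E F] {S : Fin (ℓ + 1) → Finset F}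
    {η : S (Fin.last ℓ) → Fˣ} {g : Fin ℓ → Polynomial F} {gLast : OrePoly θ}
    (hg : ∀ i, ∀ s ∈ S i.castSucc, (g i).eval s ≠ 0) (hgLast : gLast ≠ 0)
    (hco : ∀ s ∈ S (Fin.last ℓ), OrePoly.RightCoprime (OrePoly.X - OrePoly.C s) gLast)
    (c : (∀ i, S i) → E) :
    c ∈ gsmgCode E S η g gLast ↔ ∀ u : ∀ i, Fin (goppaDegrees g gLast i),
      ∑ j : (∀ i, S i), (algebraMap E F (c j) * (η (j (Fin.last ℓ)) : F)) *
        ∏ i, inverseCoeff g gLast i (j i : F) (u i) = 0 := by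
  have hcoeff : ∀ u, MvOrePoly.coeffAt (∑ j : (∀ i, S i),
      (algebraMap E F (c j) * (η (j (Fin.last ℓ)) : F)) •
        goppaPoly g gLast (fun i => (j i : F))) u =
      ∑ j : (∀ i, S i), (algebraMap E F (c j) * (η (j (Fin.last ℓ)) : F)) *
        ∏ i, inverseCoeff g gLast i (j i : F) (u i) := by
    intro u
    rw [MvOrePoly.coeffAt_sum]
    exact Finset.sum_congr rfl fun j _ => by rw [MvOrePoly.coeffAt_smul, coeffAt_goppaPoly]
  change (∑ j : (∀ i, S i), (algebraMap E F (c j) * (η (j (Fin.last ℓ)) : F)) •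
    goppaPoly g gLast (fun i => (j i : F))) = 0 ↔ _
  constructor
  · intro h u
    have := hcoeff (Finsupp.equivFunOnFinite.symm fun i => (u i : ℕ))
    rw [h] at this
    exact this.symm
  · intro h
    refine MvOrePoly.ext_coeffAt fun u => ?_
    rw [hcoeff]
    change _ = (0 : F)
    by_cases hu : ∀ i, u i < goppaDegrees g gLast i
    · exact h fun i => ⟨u i, hu i⟩
    · push Not at hu
      obtain ⟨i, hi⟩ := hu
      refine Finset.sum_eq_zero fun j _ => ?_
      have h0 := inverseCoeff_eq_zero_of_le hg hgLast hco i (j i).2 hi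
      rw [Finset.prod_eq_zero (f := fun i => inverseCoeff g gLast i (j i : F) (u i))
        (Finset.mem_univ i) h0, mul_zero]

end Goppa

end SkewGoppa

end
open SkewGoppa in
theorem mainTheorem2 {K F : Type*} [Field K] [Finite K] [Field F] [Finite F] [Algebra K F]
    (E : IntermediateField K F) (q t r : ℕ)
    (hq : Nat.card K = q) (ht : Module.finrank K F = t) (hr : Module.finrank K E = r)
    (θ : F →+* F) (hθ : ∀ a, θ a = a ^ q)
    (ℓ : ℕ) (S : Fin (ℓ + 1) → Finset F) (hS : ∀ i, (S i).Nonempty)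
    (hS_zero : (0 : F) ∉ S (Fin.last ℓ))
    (hS_ind : PIndependent θ (S (Fin.last ℓ)))
    (hS_inv : PIndependent θ ((S (Fin.last ℓ)).map ⟨fun s => s⁻¹, inv_injective⟩))
    (η : S (Fin.last ℓ) → Fˣ)
    (g : Fin ℓ → Polynomial F)
    (hg : ∀ i, ∀ s ∈ S i.castSucc, (g i).eval s ≠ 0)
    (gLast : OrePoly θ) (hgLast : gLast.Invariant)
    (hgLast_coprime : ∀ s ∈ S (Fin.last ℓ), OrePoly.RightCoprime (OrePoly.X - OrePoly.C s) gLast) :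
    codeLength (gsmgCode E S η g gLast) = (Fintype.piFinset S).card ∧
    ((Fintype.piFinset S).card : ℚ) - (t / r : ℚ) * ((∏ i, goppaDegrees g gLast i : ℕ) : ℚ)
      ≤ (Module.finrank E (gsmgCode E S η g gLast) : ℚ) ∧
    ((∀ i, goppaDegrees g gLast i ≤ (S i).card) →
      (Module.finrank E (gsmgCode E S η g gLast) : ℚ)
        ≤ ((Fintype.piFinset S).card : ℚ) - ((∏ i, goppaDegrees g gLast i : ℕ) : ℚ)) ∧
    (⨅ i, ((goppaDegrees g gLast i : ℕ∞) + 1)) ≤ minDist (gsmgCode E S η g gLast) := by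
  classical
  have hsurj : Function.Surjective θ := Finite.injective_iff_surjective.1 θ.injective
  have hcard : Fintype.card (∀ i, S i) = (Fintype.piFinset S).card := by
    simp [Fintype.card_pi, Fintype.card_piFinset]
  have hA := mem_gsmgCode_iff (E := E) (η := η) hg hgLast.1 hgLast_coprime
  have hv : ∀ i, ∀ T : Finset (S i), T.card ≤ goppaDegrees g gLast i → ∀ a : S i → F,
      (∀ k : Fin (goppaDegrees g gLast i),
        ∑ s ∈ T, a s * inverseCoeff g gLast i (s : F) k = 0) → ∀ s ∈ T, a s = 0 := by
    intro i T hT a ha s hs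
    have := eq_zero_of_sum_mul_inverseCoeff hsurj hS_zero hS_inv hg hgLast hgLast_coprime i
      (T := T.map (Function.Embedding.subtype _))
      (a := fun x => if hx : x ∈ S i then a ⟨x, hx⟩ else 0)
      (by
        intro x hx
        obtain ⟨y, -, rfl⟩ := Finset.mem_map.1 hx
        exact y.2)
      (by rwa [Finset.card_map])
      (by
        intro k hk
        rw [Finset.sum_map, ← ha ⟨k, hk⟩]
        exact Finset.sum_congr rfl fun y _ => by simp)
      (Finset.mem_map_of_mem _ hs)
    simpa using this
  have hr0 : (r : ℚ) ≠ 0 := by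
    rw [← hr]
    exact_mod_cast (Module.finrank_pos (R := K) (M := E)).ne'
  have htr : (t / r : ℚ) = Module.finrank E F := by
    rw [div_eq_iff hr0, ← ht, ← hr, mul_comm]
    exact_mod_cast (Module.finrank_mul_finrank K E F).symm
  refine ⟨hcard, ?_, fun hd => ?_, ?_⟩
  · have h := le_finrank_code (η := fun j => η (j (Fin.last ℓ)))
      (v := fun i (s : S i) (k : Fin _) => inverseCoeff g gLast i (s : F) k) hA
    rw [hcard] at h
    rw [htr, sub_le_iff_le_add]
    rw [mul_comm (∏ i, _)] at h
    exact_mod_cast h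
  · have h := finrank_code_add_prod_le (η := fun j => η (j (Fin.last ℓ)))
      (v := fun i (s : S i) (k : Fin _) => inverseCoeff g gLast i (s : F) k) hv hA
      (fun i => by simpa using hd i)
    rw [hcard] at h
    rw [le_sub_iff_add_le]
    exact_mod_cast h
  · exact iInf_le_minDist_code (η := fun j => η (j (Fin.last ℓ)))
      (v := fun i (s : S i) (k : Fin _) => inverseCoeff g gLast i (s : F) k) hv hA
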